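/- All graphs are finite, simple and undirected. Let $G$ be a graph with vertex set $V$. A set $R\subseteq\binom{V}{2}$ of unordered pairs of distinct vertices is regarded as the graph $(V,R)$, and $\mathrm{Ball}_R^r(v)$ denotes the set of vertices at distance at most $r$ from $v$ in it. A partition $\mathcal P$ of $V$ is *homogeneous modulo $R$* in $G$ if for all parts $X,Y\in\mathcal P$ (possibly $X=Y$), the pairs $xy\notin R$ with $x\in X$, $y\in Y$, $x\ne y$ are either all edges of $G$ or all non-edges of $G$. A *merge sequence* for $G$ is a sequence $(\mathcal P_1,R_1),\dots,(\mathcal P_m,R_m)$, $m\ge 1$, such that $\mathcal P_1\preceq\dots\preceq\mathcal P_m$ are ever coarser (not necessarily distinct) partitions of $V$, with $\mathcal P_1$ the partition into singletons and $\mathcal P_m$ the partition with the single part $V$; $R_1\subseteq\dots\subseteq R_m\subseteq\binom V2$; and $\mathcal P_t$ is homogeneous modulo $R_t$ in $G$ for every $1\le t\le m$. Its *radius-$r$ width* is the maximum, over all $1\le t<m$ and $v\in V$, of the number of parts of $\mathcal P_t$ that intersect $\mathrm{Ball}^r_{R_{t+1}}(v)$ (and $0$ if there are no such $t$ and $v$).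 The *radius-$r$ positive merge-width* $\mathrm{mw}_r^+(G)$ is the least radius-$r$ width of a merge sequence for $G$ such that $R_t\subseteq E(G)$ for all $t$, that is, in which only edges of $G$ are resolved. For a class $\mathscr C$ of graphs, $\mathrm{mw}_r^+(\mathscr C)=\sup\{\mathrm{mw}_r^+(G): G\in\mathscr C\}$. **Lemma.** Let $\mathscr C$ be the class of edge-complements of cubic graphs, i.e. of graphs in which every vertex has degree $3$. Then $\mathrm{mw}_1^+(\mathscr C)=\infty$. -/

import Mathlib

namespace MergeWidth

universe u

/-! Graphs are finite, simple and undirected. A partition of `V` is given by its equivalence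
relation (a `Setoid V`), whose parts are `P.classes`; `P ≤ Q` means that `P` refines `Q`.
A set of unordered pairs of distinct vertices of `V` is the same as a `SimpleGraph V`. -/

/-- The parts of the partition `P` that meet the set `S`. -/
def partsMeeting {V : Type u} (P : Setoid V) (S : Set V) : Set (Set V) :=
  {A | A ∈ P.classes ∧ (A ∩ S).Nonempty}

/-- The vertices at distance at most `r` from `v` in the graph `(V, R)`
(`edist` is `⊤` between different components). -/
def ball {V : Type u} (R : SimpleGraph V) (r : ℕ) (v : V) : Set V :=
  {w | R.edist v w ≤ (r : ℕ∞)}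

/-- The radius-`r` width of a pair `(P, R)`: the maximum over the vertices `v` of the number of
parts of `P` that meet the radius-`r` ball around `v` in `(V, R)`. -/
noncomputable def pairWidth {V : Type u} (r : ℕ) (P : Setoid V) (R : SimpleGraph V) : ℕ∞ :=
  ⨆ v : V, (partsMeeting P (ball R r v)).encard

/-- `P` is homogeneous modulo `R` in `G`: for all parts `X`, `Y` (possibly equal) of `P`, the pairs
of distinct vertices between `X` and `Y` which are not in `R` are all edges of `G` or all non-edges
of `G`. Here `x, x'` range over `X` and `y, y'` over `Y`. -/
def HomogeneousModulo {V : Type u} (G : SimpleGraph V) (P : Setoid V) (R : SimpleGraph V) : Prop :=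
  ∀ X ∈ P.classes, ∀ Y ∈ P.classes, ∀ x ∈ X, ∀ y ∈ Y, ∀ x' ∈ X, ∀ y' ∈ Y,
    x ≠ y → x' ≠ y' → ¬ R.Adj x y → ¬ R.Adj x' y' → (G.Adj x y ↔ G.Adj x' y')

/-- A merge sequence `(P 0, R 0), …, (P m, R m)` for the graph `G`. -/
structure MergeSequence {V : Type u} (G : SimpleGraph V) where
  /-- The index of the last pair. -/
  m : ℕ
  /-- The partitions. -/
  P : Fin (m + 1) → Setoid V
  /-- The sets of resolved pairs. -/
  R : Fin (m + 1) → SimpleGraph V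
  /-- The partitions become coarser. -/
  monotone_P : Monotone P
  /-- The first partition is the partition into singletons. -/
  P_zero : P 0 = ⊥
  /-- The last partition has the single part `V`. -/
  P_last : P (Fin.last m) = ⊤
  /-- Resolved pairs stay resolved. -/
  monotone_R : Monotone R
  /-- At every step the partition is homogeneous modulo the resolved pairs. -/
  homogeneous : ∀ t, HomogeneousModulo G (P t) (R t)

/-- The radius-`r` width of a merge sequence: the maximum of the widths of the pairs
`(P t, R (t + 1))`. -/
noncomputable def MergeSequence.width {V : Type u} {G : SimpleGraph V} (S : MergeSequence G)
    (r : ℕ) : ℕ∞ :=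
  ⨆ t : Fin S.m, pairWidth r (S.P t.castSucc) (S.R t.succ)

/-- A merge sequence is positive if only edges of `G` are resolved. -/
def MergeSequence.IsPositive {V : Type u} {G : SimpleGraph V} (S : MergeSequence G) : Prop :=
  ∀ t, S.R t ≤ G

/-- The radius-`r` positive merge-width of `G`: the least radius-`r` width of a positive merge
sequence for `G`. -/
noncomputable def positiveMergeWidth {V : Type u} (r : ℕ) (G : SimpleGraph V) : ℕ∞ :=
  ⨅ (S : MergeSequence G) (_ : S.IsPositive), S.width r

/-- A finite simple graph together with its vertex set. -/
structure FinGraph where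
  /-- The vertex set. -/
  V : Type u
  [fintype : Fintype V]
  /-- The graph. -/
  graph : SimpleGraph V

attribute [instance] FinGraph.fintype

/-- The radius-`r` positive merge-width of a class of finite graphs: the supremum over its
members. -/
noncomputable def classPositiveMergeWidth (r : ℕ) (C : Set FinGraph.{u}) : ℕ∞ :=
  ⨆ G ∈ C, positiveMergeWidth r G.graph

open Classical in
/-- A finite graph is cubic if every vertex has degree `3`. -/
def IsCubic {V : Type u} [Fintype V] (G : SimpleGraph V) : Prop :=
  G.IsRegularOfDegree 3

/-- The class of edge-complements of cubic graphs. -/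
def coCubicGraphs : Set FinGraph.{u} :=
  {G | ∃ H : SimpleGraph G.V, IsCubic H ∧ G.graph = Hᶜ}

end MergeWidth

/-!
Let `H` be a cubic graph on `n` vertices and suppose that `Hᶜ` has a positive merge sequence of
radius-`1` width at most `K`. No edge of `H` is ever resolved, so between two parts that are joined
by an edge of `H` every non-edge of `H` must be resolved. Consequently, at most `D = K + 3` parts of
one partition meet the `H`-neighbouring parts of any given part of the next partition
(`exists_isSparseChain`). The quotients of `H` by the partitions of the sequence thus have bounded
degree, and only exponentially many graphs, up to isomorphism, can be produced in this way, whereas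
there are more cubic graphs than that.

For the upper bound, `H` is rebuilt by running the sequence backwards, from a single part, splitting
one part into two at a time. A split only affects boundedly many pairs of parts, but naming the part
to be split would cost a factor of `n` at each step. This cost is avoided by storing, for each pair
of adjacent parts, which of the two splits first (`code`). Then a part that precedes all its
neighbours may be found from the stored data alone, and it can be split at once, even if the given
sequence would first split some other part further away. The sets of parts reached in this way
need not be partitions from the given sequence, but adjacent parts always coexist in it
(`Coherent`), which suffices to bound the degrees (`IsSparseChain.encard_le`) and to continue
(`IsSparseChain.exists_split`). Hence there are at most `C ^ n` final codes
(`exists_finset_codes`), and at most `n ^ n * C ^ n` labelled graphs (`card_le_of_isSparseChain`),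
with `C` depending on `K` only.

For the lower bound, the lifts of `K_{3,3}` by nine arbitrary permutations of `N` points are
`N! ^ 9` distinct cubic graphs on `n = 6 * N` vertices (`lift_injective`, `isCubic_lift`), which is
more than `n ^ n * C ^ n` for large `N`.
-/

universe u

namespace MergeWidth

/-! ### Splitting the vertex set along a chain of partitions -/

section Splitting

variable {V : Type u}

/-- The vertices whose part in `P` is joined by an edge of `H` to the part of `v`. -/
def nearby (H : SimpleGraph V) (P : Setoid V) (v : V) : Set V :=
  {w | ∃ x y, P v x ∧ H.Adj x y ∧ P y w}

/-- A chain of partitions, from the singletons to the trivial partition, such that the part of each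
vertex `v` in `P (t + 1)` has few neighbouring parts, and these are cut into few pieces by `P t`: at
most `D` parts of `P t` meet the union of the parts of `P (t + 1)` that are `H`-adjacent to that of
`v`. The bound is expressed through sets `s` of representatives of distinct parts of `P t`. -/
structure IsSparseChain (H : SimpleGraph V) (D : ℕ) (P : ℕ → Setoid V) : Prop where
  mono : Monotone P
  zero : P 0 = ⊥
  top : ∃ m, P m = ⊤
  card_le : ∀ t v (s : Finset V), (∀ w ∈ s, w ∈ nearby H (P (t + 1)) v) →
    (∀ w ∈ s, ∀ w' ∈ s, P t w w' → w = w') → s.card ≤ D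

/-- The first time at which the fibre of `φ` over `i` lies in a single part of the chain `P`. -/
noncomputable def level (P : ℕ → Setoid V) (φ : V → ℕ) (i : ℕ) : ℕ :=
  sInf {t | ∀ x y, φ x = i → φ y = i → P t x y}

/-- Some edge of `H` joins the fibres of `φ` over `i` and `j`. -/
def FibreAdj (H : SimpleGraph V) (φ : V → ℕ) (i j : ℕ) : Prop :=
  ∃ x y, φ x = i ∧ φ y = j ∧ H.Adj x y

open Classical in
/-- The quotient of `H` by the fibres of `φ` (with loops), where every adjacent pair `(i, j)` is
labelled by whether the fibre over `i` is not a singleton and is to be split no later than the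
fibre over `j`. -/
noncomputable def code (H : SimpleGraph V) (P : ℕ → Setoid V) (φ : V → ℕ) :
    ℕ → ℕ → Option Bool := fun i j =>
  if FibreAdj H φ i j then some (decide (1 ≤ level P φ i ∧ level P φ j ≤ level P φ i)) else none

/-- Fibres which are adjacent (or equal) coexist: at the last time before the fibre over `i` lies in
a single part, the fibre over `j` is a union of parts. If the fibre over `i` is a singleton, then
its level is `0` and the truncated `0 - 1 = 0` stands for the partition into singletons, for which
the condition is void. -/
def Coherent (H : SimpleGraph V) (P : ℕ → Setoid V) (φ : V → ℕ) : Prop :=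
  ∀ i j, (i = j ∨ FibreAdj H φ i j) →
    ∀ x y, φ x = j → P (level P φ i - 1) x y → φ y = j

/-- The fibre over `i` may be split next: it is not a singleton and no neighbour splits before it.
The first condition excludes singletons, whose row in a code never contains `some true`. -/
def IsSource (f : ℕ → ℕ → Option Bool) (i : ℕ) : Prop :=
  (∃ j, f i j = some true) ∧ ∀ j, f i j ≠ some false

variable {H : SimpleGraph V} {D : ℕ} {P : ℕ → Setoid V} {φ : V → ℕ} {i j k : ℕ}

lemma FibreAdj.symm (h : FibreAdj H φ i j) : FibreAdj H φ j i := by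
  obtain ⟨x, y, hx, hy, h⟩ := h
  exact ⟨y, x, hy, hx, h.symm⟩

lemma code_ne_none : code H P φ i j ≠ none ↔ FibreAdj H φ i j := by
  unfold code; split_ifs with h <;> simp [h]

lemma IsSparseChain.rel_level (hP : IsSparseChain H D P) {x y : V} (hx : φ x = i) (hy : φ y = i) :
    P (level P φ i) x y := by
  have hne : {t | ∀ x y, φ x = i → φ y = i → P t x y}.Nonempty := by
    obtain ⟨m, hm⟩ := hP.top
    exact ⟨m, fun x y _ _ => by rw [hm]; trivial⟩
  exact Nat.sInf_mem hne x y hx hy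

lemma level_le {t : ℕ} (h : ∀ x y, φ x = i → φ y = i → P t x y) : level P φ i ≤ t :=
  Nat.sInf_le h

lemma IsSource.level_le_of_fibreAdj (hi : IsSource (code H P φ) i) :
    1 ≤ level P φ i ∧ ∀ j, FibreAdj H φ i j → level P φ j ≤ level P φ i := by
  obtain ⟨⟨j, hj⟩, h⟩ := hi
  constructor
  · unfold code at hj
    split_ifs at hj
    simp only [Option.some.injEq, decide_eq_true_eq] at hj
    exact hj.1
  · intro j hadj
    have := h j
    unfold code at this
    rw [if_pos hadj] at this
    simp only [ne_eq, Option.some.injEq, decide_eq_false_iff_not, not_not] at this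
    exact this.2

/-- A fibre of largest level among all fibres is a source. -/
lemma IsSparseChain.exists_isSource [Finite V] (hP : IsSparseChain H D P)
    (hH : ∀ x, ∃ y, H.Adj x y) (hφ : ¬ Function.Injective φ) :
    ∃ i, IsSource (code H P φ) i := by
  simp only [Function.Injective, not_forall] at hφ
  obtain ⟨a, b, hab, hne⟩ := hφ
  have : Nonempty V := ⟨a⟩
  obtain ⟨x, hx⟩ := Finite.exists_max fun x => level P φ (φ x)
  have h1 : 1 ≤ level P φ (φ x) := by
    refine le_trans ?_ (hx a)
    by_contra h0
    have h := hP.rel_level (φ := φ) rfl hab.symm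
    rw [show level P φ (φ a) = 0 by omega, hP.zero] at h
    exact hne h
  obtain ⟨y, hy⟩ := hH x
  refine ⟨φ x, ⟨φ y, ?_⟩, fun j => ?_⟩
  · unfold code
    rw [if_pos ⟨x, y, rfl, rfl, hy⟩]
    simpa using ⟨h1, hx y⟩
  · unfold code
    split_ifs with h
    · obtain ⟨_, z, _, rfl, _⟩ := h
      simpa using ⟨h1, hx z⟩
    · simp

/-- A fibre that is ready to be split has few neighbours: they contain distinct parts of the chain
at the last time before the fibre lies in a single part. -/
lemma IsSparseChain.encard_le (hP : IsSparseChain H D P) (hφ : Coherent H P φ)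
    (hi : IsSource (code H P φ) i) : {j | code H P φ i j ≠ none}.encard ≤ D := by
  classical
  obtain ⟨h1, -⟩ := IsSource.level_le_of_fibreAdj hi
  by_contra hlt
  push Not at hlt
  obtain ⟨t, ht, hcard⟩ := Set.exists_subset_encard_eq (Order.add_one_le_of_lt hlt)
  have hfin : t.Finite := Set.finite_of_encard_eq_coe (k := D + 1) (by simpa using hcard)
  have hadj : ∀ j : ℕ, j ∈ t → ∃ x y, φ x = i ∧ φ y = j ∧ H.Adj x y :=
    fun j hj => code_ne_none.1 (ht hj)
  have hne : t.Nonempty := by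
    rw [← Set.encard_pos, hcard]; positivity
  obtain ⟨j₀, hj₀⟩ := hne
  obtain ⟨v, -, hv, -, -⟩ := hadj j₀ hj₀
  have : Nonempty V := ⟨v⟩
  choose! x y hx hy hxy using hadj
  have hl : level P φ i - 1 + 1 = level P φ i := by omega
  -- One representative in each of the neighbouring fibres; coherence separates them.
  have hc := hP.card_le (level P φ i - 1) v (hfin.toFinset.image y) ?_ ?_
  · rw [Finset.card_image_of_injOn] at hc
    · rw [hfin.encard_eq_coe_toFinset_card] at hcard
      have : hfin.toFinset.card = D + 1 := by exact_mod_cast hcard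
      omega
    · intro a ha b hb hab
      simp only [Set.Finite.coe_toFinset] at ha hb
      rw [← hy a ha, ← hy b hb, hab]
  · intro w hw
    simp only [Finset.mem_image, Set.Finite.mem_toFinset] at hw
    obtain ⟨j, hj, rfl⟩ := hw
    rw [hl]
    exact ⟨x j, y j, hP.rel_level hv (hx j hj), hxy j hj, Setoid.refl' _ _⟩
  · intro w hw w' hw' h
    simp only [Finset.mem_image, Set.Finite.mem_toFinset] at hw hw'
    obtain ⟨j, hj, rfl⟩ := hw
    obtain ⟨j', hj', rfl⟩ := hw'
    have := hφ i j (Or.inr ⟨x j, y j, hx j hj, hy j hj, hxy j hj⟩) _ _ (hy j hj) h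
    rw [hy j' hj'] at this
    rw [this]

lemma level_congr {ψ : V → ℕ} (h : ∀ x, ψ x = i ↔ φ x = i) : level P ψ i = level P φ i := by
  simp only [level, h]

/-- Splitting a source into two fibres, the new one over the fresh index `k`, changes the code only
at pairs made of `i` or `k` and of a neighbour of `i`. -/
lemma IsSparseChain.exists_split (hP : IsSparseChain H D P) (hφ : Coherent H P φ)
    (hr : ∀ j, (∃ x, φ x = j) ↔ j < k) (hi : IsSource (code H P φ) i) :
    ∃ ψ : V → ℕ, Coherent H P ψ ∧ (∀ j, (∃ x, ψ x = j) ↔ j < k + 1) ∧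
      ∀ a b, code H P ψ a b ≠ code H P φ a b →
        ((a = i ∨ a = k) ∧ (b = i ∨ b = k ∨ code H P φ i b ≠ none)) ∨
        ((b = i ∨ b = k) ∧ (a = i ∨ a = k ∨ code H P φ i a ≠ none)) := by
  classical
  obtain ⟨h1, hmax⟩ := IsSource.level_le_of_fibreAdj hi
  set l := level P φ i with hl
  obtain ⟨x₀, y₀, hx₀, hy₀, hxy⟩ : ∃ x y, φ x = i ∧ φ y = i ∧ ¬ P (l - 1) x y := by
    by_contra! h
    have := level_le h
    omega
  have hik : i < k := (hr i).1 ⟨x₀, hx₀⟩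
  have hk : ∀ x, φ x ≠ k := fun x hx => absurd ((hr k).1 ⟨x, hx⟩) (lt_irrefl _)
  have hY : ∀ z, P (l - 1) x₀ z → φ z = i := fun z hz => hφ i i (Or.inl rfl) _ _ hx₀ hz
  -- The fresh fibre is a single part of `P (l - 1)`, properly contained in the fibre over `i`.
  let ψ : V → ℕ := fun z => if P (l - 1) x₀ z then k else φ z
  have hψk : ∀ z, ψ z = k ↔ P (l - 1) x₀ z := by
    intro z; simp only [ψ]; split_ifs with h <;> simp [h, hk]
  have hψi : ∀ z, ψ z = i ↔ φ z = i ∧ ¬ P (l - 1) x₀ z := by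
    intro z; simp only [ψ]; split_ifs with h <;> simp [h, hik.ne']
  have hψj : ∀ j, j ≠ i → j ≠ k → ∀ z, ψ z = j ↔ φ z = j := by
    intro j hji hjk z
    simp only [ψ]
    split_ifs with h
    · simp [hjk.symm, hY z h, hji.symm]
    · rfl
  have hsub : ∀ c, (c = i ∨ c = k) → ∀ z, ψ z = c → φ z = i := by
    rintro c (rfl | rfl) z hz
    · exact ((hψi z).1 hz).1
    · exact hY z ((hψk z).1 hz)
  have hsat : ∀ c, (c = i ∨ c = k) → ∀ x y, ψ x = c → P (l - 1) x y → ψ y = c := by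
    rintro c (rfl | rfl) x y hx hxy
    · rw [hψi] at hx ⊢
      exact ⟨hφ c c (Or.inl rfl) _ _ hx.1 hxy,
        fun h => hx.2 (Setoid.trans' _ h (Setoid.symm' _ hxy))⟩
    · rw [hψk] at hx ⊢
      exact Setoid.trans' _ hx hxy
  have hlev : ∀ c, (c = i ∨ c = k) → level P ψ c ≤ l := fun c hc =>
    level_le fun x y hx hy => hP.rel_level (hsub c hc x hx) (hsub c hc y hy)
  have hadj : ∀ a b, (a = i ∨ a = k) → ¬ (b = i ∨ b = k) → FibreAdj H ψ a b →
      FibreAdj H φ i b := by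
    rintro a b ha hb ⟨x, y, hx, hy, h⟩
    push Not at hb
    exact ⟨x, y, hsub a ha x hx, (hψj b hb.1 hb.2 y).1 hy, h⟩
  have hadj' : ∀ a b, ¬ (a = i ∨ a = k) → ¬ (b = i ∨ b = k) →
      (FibreAdj H ψ a b ↔ FibreAdj H φ a b) := by
    intro a b ha hb
    push Not at ha hb
    simp only [FibreAdj, hψj a ha.1 ha.2, hψj b hb.1 hb.2]
  have hlev' : ∀ c, ¬ (c = i ∨ c = k) → level P ψ c = level P φ c := by
    intro c hc
    push Not at hc
    exact level_congr (hψj c hc.1 hc.2)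
  refine ⟨ψ, ?_, ?_, ?_⟩
  · intro a b hab x y hx hxy
    by_cases hb : b = i ∨ b = k
    · have ha : level P ψ a ≤ l := by
        by_cases ha : a = i ∨ a = k
        · exact hlev a ha
        · rw [hlev' a ha]
          rcases hab with rfl | hab
          · exact absurd hb ha
          · exact hmax a (hadj b a hb ha hab.symm)
      exact hsat b hb x y hx (hP.mono (by omega : level P ψ a - 1 ≤ l - 1) hxy)
    · have hb' := hb
      push Not at hb'
      rw [hψj b hb'.1 hb'.2] at hx ⊢
      by_cases ha : a = i ∨ a = k
      · rcases hab with rfl | hab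
        · exact absurd ha hb
        · have := hlev a ha
          exact hφ i b (Or.inr (hadj a b ha hb hab)) x y hx
            (hP.mono (by omega : level P ψ a - 1 ≤ l - 1) hxy)
      · rw [hlev' a ha] at hxy
        exact hφ a b (hab.imp id (hadj' a b ha hb).1) x y hx hxy
  · intro j
    by_cases hjk : j = k
    · subst hjk
      simpa using ⟨x₀, (hψk x₀).2 (Setoid.refl' _ _)⟩
    by_cases hji : j = i
    · subst hji
      refine iff_of_true ⟨y₀, (hψi y₀).2 ⟨hy₀, hxy⟩⟩ (by omega)
    · simp only [hψj j hji hjk, hr]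
      omega
  · intro a b hab
    by_contra! hcon
    obtain ⟨hA, hB⟩ := hcon
    apply hab
    by_cases ha : a = i ∨ a = k
    · obtain ⟨hbi, hbk, hb⟩ := hA ha
      have hib : ¬ FibreAdj H φ i b := fun h => code_ne_none.2 h hb
      have e1 : ¬ FibreAdj H ψ a b := fun h => hib (hadj a b ha (by tauto) h)
      have e2 : ¬ FibreAdj H φ a b := by
        rcases ha with rfl | rfl
        · exact hib
        · rintro ⟨x, -, hx, -⟩; exact hk x hx
      simp [code, e1, e2]
    by_cases hb : b = i ∨ b = k
    · obtain ⟨hai, hak, haa⟩ := hB hb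
      have hia : ¬ FibreAdj H φ i a := fun h => code_ne_none.2 h haa
      have e1 : ¬ FibreAdj H ψ a b := fun h => hia (hadj b a hb (by tauto) h.symm)
      have e2 : ¬ FibreAdj H φ a b := by
        rcases hb with rfl | rfl
        · exact fun h => hia h.symm
        · rintro ⟨-, y, -, hy, -⟩; exact hk y hy
      simp [code, e1, e2]
    · simp only [code, hadj' a b ha hb, hlev' a ha, hlev' b hb]

end Splitting

/-! ### The number of graphs with a sparse chain -/

section Counting

lemma exists_finset_modifications (T : Finset (ℕ × ℕ)) (f : ℕ → ℕ → Option Bool) :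
    ∃ U : Finset (ℕ → ℕ → Option Bool), U.card ≤ 3 ^ T.card ∧
      ∀ g, (∀ a b, g a b ≠ f a b → (a, b) ∈ T) → g ∈ U := by
  classical
  refine ⟨Finset.univ.image fun (h : T → Option Bool) a b =>
    if hab : (a, b) ∈ T then h ⟨(a, b), hab⟩ else f a b, ?_, fun g hg => ?_⟩
  · refine Finset.card_image_le.trans ?_
    simp
  · refine Finset.mem_image.2 ⟨fun p => g p.1.1 p.1.2, Finset.mem_univ _, ?_⟩
    funext a b
    by_cases hab : (a, b) ∈ T
    · simp [hab]
    · simp only [hab, dite_false]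
      by_contra h
      exact hab (hg a b (Ne.symm h))

/-- The source to be split depends on the code only, so a code has boundedly many successors. -/
lemma exists_finset_successors (D k : ℕ) (f : ℕ → ℕ → Option Bool) :
    ∃ U : Finset (ℕ → ℕ → Option Bool), U.card ≤ 3 ^ (4 * (D + 2)) ∧
      ((∃ i, IsSource f i) → ∃ i, IsSource f i ∧ ({j | f i j ≠ none}.encard ≤ D →
        ∀ g : ℕ → ℕ → Option Bool, (∀ a b, g a b ≠ f a b →
          ((a = i ∨ a = k) ∧ (b = i ∨ b = k ∨ f i b ≠ none)) ∨
          ((b = i ∨ b = k) ∧ (a = i ∨ a = k ∨ f i a ≠ none))) → g ∈ U)) := by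
  classical
  by_cases hs : ∃ i, IsSource f i
  swap
  · exact ⟨∅, by simp, fun h => absurd h hs⟩
  obtain ⟨i, hi⟩ := hs
  by_cases hN : {j | f i j ≠ none}.encard ≤ D
  swap
  · exact ⟨∅, by simp, fun _ => ⟨i, hi, fun h => absurd h hN⟩⟩
  have hfin : {j | f i j ≠ none}.Finite := Set.finite_of_encard_le_coe hN
  let A : Finset ℕ := {i, k}
  let B : Finset ℕ := A ∪ hfin.toFinset
  have hA : A.card ≤ 2 := Finset.card_le_two
  have hB : B.card ≤ D + 2 := by
    rw [hfin.encard_eq_coe_toFinset_card] at hN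
    have : hfin.toFinset.card ≤ D := by exact_mod_cast hN
    exact (Finset.card_union_le A hfin.toFinset).trans (by omega)
  obtain ⟨U, hU, h⟩ := exists_finset_modifications (A ×ˢ B ∪ B ×ˢ A) f
  refine ⟨U, hU.trans (Nat.pow_le_pow_right (by norm_num) ?_), fun _ => ⟨i, hi, fun _ g hg => ?_⟩⟩
  · refine (Finset.card_union_le _ _).trans ?_
    rw [Finset.card_product, Finset.card_product]
    nlinarith
  · refine h g fun a b hab => ?_
    have := hg a b hab
    simp only [Finset.mem_union, Finset.mem_product, A, B, Finset.mem_insert,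
      Finset.mem_singleton, Set.Finite.mem_toFinset, Set.mem_ofPred_eq]
    tauto

/-- The quotients with `k + 1` fibres, produced by always splitting the chosen source, have at most
exponentially many codes. -/
lemma exists_finset_codes (V : Type u) [Fintype V] (D k : ℕ) :
    ∃ S : Finset (ℕ → ℕ → Option Bool), S.card ≤ (3 ^ (4 * (D + 2))) ^ (k + 1) ∧
      ∀ (H : SimpleGraph V) (P : ℕ → Setoid V), IsSparseChain H D P → (∀ x, ∃ y, H.Adj x y) →
        k + 1 ≤ Fintype.card V →
        ∃ φ : V → ℕ, Coherent H P φ ∧ (∀ j, (∃ x, φ x = j) ↔ j < k + 1) ∧ code H P φ ∈ S := by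
  classical
  induction k with
  | zero =>
    obtain ⟨U, hU, h⟩ := exists_finset_modifications {(0, 0)} fun _ _ => none
    refine ⟨U, hU.trans ?_, fun H P hP hH hV => ?_⟩
    · rw [Finset.card_singleton, zero_add, pow_one, pow_one]
      exact Nat.le_self_pow (by omega) 3
    · have : Nonempty V := Fintype.card_pos_iff.1 (by omega)
      refine ⟨fun _ => 0, ?_, ?_, h _ fun a b hab => ?_⟩
      · rintro i j h x y hx -
        exact hx
      · intro j
        simp [eq_comm]
      · obtain ⟨-, -, rfl, rfl, -⟩ := code_ne_none.1 hab
        simp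
  | succ k ih =>
    obtain ⟨S, hS, h⟩ := ih
    choose U hU hsucc using exists_finset_successors D (k + 1)
    refine ⟨S.biUnion U, ?_, fun H P hP hH hV => ?_⟩
    · rw [pow_succ (3 ^ (4 * (D + 2))) (k + 1)]
      exact (Finset.card_biUnion_le_card_mul _ _ _ fun f _ => hU f).trans
        (Nat.mul_le_mul_right _ hS)
    · obtain ⟨φ, hφ, hr, hmem⟩ := h H P hP hH (by omega)
      have hinj : ¬ Function.Injective φ := by
        intro hinj
        have : Fintype.card V ≤ (Finset.range (k + 1)).card :=
          Finset.card_le_card_of_injOn φ (fun x _ => by simpa using (hr _).1 ⟨x, rfl⟩)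
            hinj.injOn
        rw [Finset.card_range] at this
        omega
      obtain ⟨i, hi, hsucc⟩ := hsucc _ (hP.exists_isSource hH hinj)
      obtain ⟨ψ, hψ, hrψ, hdiff⟩ := hP.exists_split hφ hr hi
      exact ⟨ψ, hψ, hrψ, Finset.mem_biUnion.2 ⟨_, hmem, hsucc (hP.encard_le hφ hi) _ hdiff⟩⟩

/-- A family of graphs with sparse chains has at most `n ^ n * C ^ n` members: a graph is determined
by the code with singleton fibres and the numbering of its vertices. -/
lemma card_le_of_isSparseChain (V : Type u) [Fintype V] [Nonempty V] (D : ℕ) {ι : Type*} [Fintype ι]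
    (H : ι → SimpleGraph V) (hinj : Function.Injective H) (hH : ∀ a x, ∃ y, (H a).Adj x y)
    (hP : ∀ a, ∃ P, IsSparseChain (H a) D P) :
    Fintype.card ι ≤ Fintype.card V ^ Fintype.card V *
      (3 ^ (4 * (D + 2))) ^ Fintype.card V := by
  classical
  have hpos : 0 < Fintype.card V := Fintype.card_pos
  obtain ⟨S, hS, h⟩ := exists_finset_codes V D (Fintype.card V - 1)
  rw [Nat.sub_add_cancel hpos] at hS h
  -- There are as many fibres as vertices, so that all the fibres are singletons.
  choose P hP using hP
  choose φ _ hr hmem using fun a => h (H a) (P a) (hP a) (hH a) le_rfl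
  have hφ : ∀ a, Function.Injective (φ a) := by
    intro a
    have hsurj : Function.Surjective fun x : V =>
        (⟨φ a x, (hr a _).1 ⟨x, rfl⟩⟩ : Fin (Fintype.card V)) := by
      rintro ⟨j, hj⟩
      obtain ⟨x, hx⟩ := (hr a j).2 hj
      exact ⟨x, Fin.ext hx⟩
    have hbij := (Fintype.bijective_iff_surjective_and_card _).2 ⟨hsurj, by simp⟩
    intro x y hxy
    exact hbij.1 (Fin.ext hxy)
  have hadj : ∀ a x y, (H a).Adj x y ↔ code (H a) (P a) (φ a) (φ a x) (φ a y) ≠ none := by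
    intro a x y
    rw [code_ne_none]
    refine ⟨fun h => ⟨x, y, rfl, rfl, h⟩, ?_⟩
    rintro ⟨x', y', hx, hy, h⟩
    rwa [hφ a hx, hφ a hy] at h
  let F : ι → (V → Fin (Fintype.card V)) × S := fun a =>
    (fun x => ⟨φ a x, (hr a _).1 ⟨x, rfl⟩⟩, ⟨_, hmem a⟩)
  have hF : Function.Injective F := by
    intro a b hab
    simp only [F, Prod.mk.injEq, Subtype.mk.injEq] at hab
    obtain ⟨h1, h2⟩ := hab
    have h1' : φ a = φ b := funext fun x => congrArg Fin.val (congrFun h1 x)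
    apply hinj
    ext x y
    rw [hadj, hadj, h2, h1']
  refine (Fintype.card_le_of_injective F hF).trans ?_
  simp only [Fintype.card_prod, Fintype.card_fun, Fintype.card_fin, Fintype.card_coe]
  exact Nat.mul_le_mul_left _ hS

end Counting

/-! ### Many cubic graphs -/

section Lifts

variable {α : Type u}

/-- The lift of `K_{3,3}` in which the fibres over the vertices `i` and `j` on either side are
matched by the permutation `σ i j`. -/
def lift (σ : Fin 3 → Fin 3 → Equiv.Perm α) : SimpleGraph (Fin 3 × α ⊕ Fin 3 × α) where
  Adj
    | .inl p, .inr q => σ p.1 q.1 p.2 = q.2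
    | .inr q, .inl p => σ p.1 q.1 p.2 = q.2
    | _, _ => False
  symm := ⟨by rintro (p | p) (q | q) h <;> exact h⟩
  loopless := ⟨by rintro (p | p) h <;> exact h⟩

@[simp] lemma lift_adj_inl_inr (σ : Fin 3 → Fin 3 → Equiv.Perm α) (p q : Fin 3 × α) :
    (lift σ).Adj (.inl p) (.inr q) ↔ σ p.1 q.1 p.2 = q.2 := Iff.rfl

@[simp] lemma lift_adj_inr_inl (σ : Fin 3 → Fin 3 → Equiv.Perm α) (p q : Fin 3 × α) :
    (lift σ).Adj (.inr q) (.inl p) ↔ σ p.1 q.1 p.2 = q.2 := Iff.rfl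

@[simp] lemma not_lift_adj_inl_inl (σ : Fin 3 → Fin 3 → Equiv.Perm α) (p q : Fin 3 × α) :
    ¬ (lift σ).Adj (.inl p) (.inl q) := id

@[simp] lemma not_lift_adj_inr_inr (σ : Fin 3 → Fin 3 → Equiv.Perm α) (p q : Fin 3 × α) :
    ¬ (lift σ).Adj (.inr p) (.inr q) := id

lemma lift_injective : Function.Injective (lift (α := α)) := by
  intro σ τ h
  funext i j
  ext x
  have : (lift τ).Adj (.inl (i, x)) (.inr (j, σ i j x)) := by
    rw [← h, lift_adj_inl_inr]
  exact ((lift_adj_inl_inr ..).1 this).symm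

lemma isCubic_lift [Fintype α] (σ : Fin 3 → Fin 3 → Equiv.Perm α) : IsCubic (lift σ) := by
  classical
  intro v
  rw [← SimpleGraph.card_neighborFinset_eq_degree]
  rcases v with ⟨i, x⟩ | ⟨j, y⟩
  · rw [show (lift σ).neighborFinset (.inl (i, x)) =
      Finset.univ.image fun j => Sum.inr (j, σ i j x) from ?_, Finset.card_image_of_injective]
    · simp
    · intro a b h
      simpa using congrArg (fun s => s.elim Prod.fst Prod.fst) h
    · ext (⟨a, z⟩ | ⟨a, z⟩) <;> simp
  · rw [show (lift σ).neighborFinset (.inr (j, y)) =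
      Finset.univ.image fun i => Sum.inl (i, (σ i j).symm y) from ?_,
      Finset.card_image_of_injective]
    · simp
    · intro a b h
      simpa using congrArg (fun s => s.elim Prod.fst Prod.fst) h
    · ext (⟨a, z⟩ | ⟨a, z⟩)
      · have : σ a j z = y ↔ (σ a j).symm y = z := by rw [Equiv.symm_apply_eq, eq_comm]
        simpa using this
      · simp

end Lifts

/-! ### From positive merge sequences to sparse chains -/

section MergeSequences

variable {V : Type u}

lemma IsCubic.encard_neighborSet [Fintype V] {H : SimpleGraph V} (hH : IsCubic H) (v : V) :
    (H.neighborSet v).encard = 3 := by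
  classical
  have := hH v
  rw [← SimpleGraph.card_neighborFinset_eq_degree] at this
  rw [← SimpleGraph.coe_neighborFinset, Set.encard_coe_eq_coe_finsetCard]
  exact_mod_cast this

/-- In a positive merge sequence for the complement of `H`, no edge of `H` is ever resolved, so all
non-edges of `H` between `H`-adjacent parts must be resolved. Hence the radius-`1` ball of `v`
contains everything near `v` except its `H`-neighbours. -/
lemma exists_isSparseChain [Fintype V] {H : SimpleGraph V} (hH : IsCubic H) {K : ℕ}
    (S : MergeSequence Hᶜ) (hS : S.IsPositive) (hK : S.width 1 ≤ K) :
    ∃ P, IsSparseChain H (K + 3) P := by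
  classical
  have hlt : ∀ t, min t S.m < S.m + 1 := fun t => by omega
  -- The sequence of partitions is continued by its last term.
  refine ⟨fun t => S.P ⟨min t S.m, hlt t⟩, fun s t hst => S.monotone_P ?_, ?_, ⟨S.m, ?_⟩, ?_⟩
  · exact Fin.mk_le_mk.2 (min_le_min_right _ hst)
  · rw [← S.P_zero]; congr 1
  · rw [← S.P_last]; congr 1; ext; exact min_self _
  intro t v s hs hinj
  by_cases ht : t < S.m
  swap
  · have htop : S.P ⟨min t S.m, hlt t⟩ = ⊤ := by
      rw [← S.P_last]; congr 1; ext; exact min_eq_right (not_lt.1 ht)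
    refine (Finset.card_le_one.2 fun a ha b hb => hinj a ha b hb ?_).trans (by omega)
    rw [htop]
    trivial
  let T : Fin S.m := ⟨t, ht⟩
  have e1 : (⟨min t S.m, hlt t⟩ : Fin (S.m + 1)) = T.castSucc := by ext; simp [T]; omega
  have e2 : (⟨min (t + 1) S.m, hlt (t + 1)⟩ : Fin (S.m + 1)) = T.succ := by ext; simp [T]; omega
  replace hinj : ∀ w ∈ s, ∀ w' ∈ s, S.P T.castSucc w w' → w = w' := e1 ▸ hinj
  replace hs : ∀ w ∈ s, w ∈ nearby H (S.P T.succ) v := e2 ▸ hs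
  have hball : (partsMeeting (S.P T.castSucc) (ball (S.R T.succ) 1 v)).encard ≤ K :=
    ((le_iSup (fun v => (partsMeeting (S.P T.castSucc) (ball (S.R T.succ) 1 v)).encard) v).trans
      (le_iSup (fun T : Fin S.m => pairWidth 1 (S.P T.castSucc) (S.R T.succ)) T)).trans hK
  have hcover : ∀ w ∈ s, w ∉ ball (S.R T.succ) 1 v → H.Adj v w := by
    intro w hw hwb
    obtain ⟨x, y, hvx, hxy, hyw⟩ := hs w hw
    by_contra hvw
    apply hwb
    by_cases hne : v = w
    · subst hne; simp [ball]
    by_contra hR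
    have hR' : ¬ (S.R T.succ).Adj v w := fun h => hR (by
      simp [ball, SimpleGraph.edist_eq_one_iff_adj.2 h])
    have hRxy : ¬ (S.R T.succ).Adj x y := fun h =>
      ((SimpleGraph.compl_adj _ _ _).1 (hS _ h)).2 hxy
    -- Neither `vw` nor `xy` is resolved, but `xy` is an edge of `H` and `vw` is not.
    have := S.homogeneous T.succ {z | S.P T.succ z v} (Setoid.mem_classes _ v)
      {z | S.P T.succ z w} (Setoid.mem_classes _ w) v (Setoid.refl' _ _) w (Setoid.refl' _ _)
      x (Setoid.symm' _ hvx) y hyw hne hxy.ne hR' hRxy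
    rw [SimpleGraph.compl_adj, SimpleGraph.compl_adj] at this
    exact (this.1 ⟨hne, hvw⟩).2 hxy
  have h1 : ((s.filter (· ∈ ball (S.R T.succ) 1 v) : Finset V) : Set V).encard ≤ K := by
    refine le_trans (Set.encard_le_encard_of_injOn (f := fun w => {z | S.P T.castSucc z w}) ?_ ?_)
      hball
    · intro w hw
      simp only [Finset.coe_filter, Set.mem_ofPred_eq] at hw
      exact ⟨Setoid.mem_classes _ w, w, Setoid.refl' _ _, hw.2⟩
    · intro w hw w' hw' h
      simp only [Finset.coe_filter, Set.mem_ofPred_eq] at hw hw'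
      have : w ∈ {z | S.P T.castSucc z w'} := by
        have h : {z | S.P T.castSucc z w} = {z | S.P T.castSucc z w'} := h
        rw [← h]; exact Setoid.refl' _ _
      exact hinj w hw.1 w' hw'.1 this
  have h2 : ((s.filter (· ∉ ball (S.R T.succ) 1 v) : Finset V) : Set V).encard ≤ 3 := by
    rw [← hH.encard_neighborSet v]
    refine Set.encard_le_encard fun w hw => ?_
    simp only [Finset.coe_filter, Set.mem_ofPred_eq] at hw
    exact hcover w hw.1 hw.2
  rw [Set.encard_coe_eq_coe_finsetCard] at h1 h2
  have h1' : (s.filter (· ∈ ball (S.R T.succ) 1 v)).card ≤ K := by exact_mod_cast h1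
  have h2' : (s.filter (· ∉ ball (S.R T.succ) 1 v)).card ≤ 3 := by exact_mod_cast h2
  rw [← Finset.card_filter_add_card_filter_not (s := s) (· ∈ ball (S.R T.succ) 1 v)]
  omega

end MergeSequences

/-- There are more lifts of `K_{3,3}` with fibres of size `N` than the upper bound on the number of
graphs of bounded width allows: by `N! ≥ (N / e) ^ N` the ratio is at least
`(N ^ 3 / (e ^ 9 * (6 * C) ^ 6)) ^ N`. -/
lemma exists_pow_lt_factorial_pow (C : ℕ) :
    ∃ N : ℕ, 0 < N ∧ (6 * N) ^ (6 * N) * C ^ (6 * N) < N.factorial ^ 9 := by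
  obtain ⟨N, hN⟩ := exists_nat_gt (Real.exp 9 * (6 * C) ^ 6 : ℝ)
  have hpos : (0 : ℝ) < N := lt_of_le_of_lt (by positivity) hN
  have hpos' : 0 < N := by exact_mod_cast hpos
  refine ⟨N, hpos', ?_⟩
  have hfac : (N : ℝ) ^ N ≤ Real.exp N * N.factorial := by
    have := Real.pow_div_factorial_le_exp (N : ℝ) hpos.le N
    rwa [div_le_iff₀ (by positivity)] at this
  have key : Real.exp 9 * (6 * N * C : ℝ) ^ 6 < (N : ℝ) ^ 9 := by
    have h1 : (1 : ℝ) ≤ N := by exact_mod_cast hpos'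
    calc Real.exp 9 * (6 * N * C : ℝ) ^ 6 = (Real.exp 9 * (6 * C) ^ 6) * (N : ℝ) ^ 6 := by ring
      _ < N * (N : ℝ) ^ 6 := by gcongr
      _ = (N : ℝ) ^ 7 := by ring
      _ ≤ (N : ℝ) ^ 9 := pow_le_pow_right₀ h1 (by norm_num)
  have key2 : (Real.exp 9 * (6 * N * C : ℝ) ^ 6) ^ N < (Real.exp N * N.factorial) ^ 9 := by
    calc (Real.exp 9 * (6 * N * C : ℝ) ^ 6) ^ N < ((N : ℝ) ^ 9) ^ N :=
          pow_lt_pow_left₀ key (by positivity) hpos'.ne'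
      _ = ((N : ℝ) ^ N) ^ 9 := by rw [← pow_mul, ← pow_mul, mul_comm]
      _ ≤ _ := by gcongr
  have hexp : Real.exp 9 ^ N = Real.exp N ^ 9 := by
    rw [← Real.exp_nat_mul, ← Real.exp_nat_mul]; congr 1; push_cast; ring
  rw [mul_pow _ _ N, mul_pow _ _ 9, hexp, mul_lt_mul_iff_right₀ (by positivity), ← pow_mul] at key2
  rw [← mul_pow]
  exact_mod_cast key2

end MergeWidth

open MergeWidth in
theorem lemma4p3 :
    MergeWidth.classPositiveMergeWidth 1 MergeWidth.coCubicGraphs.{u} = ⊤ := by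
  by_contra hne
  obtain ⟨K, hK⟩ := ENat.ne_top_iff_exists.1 hne
  obtain ⟨N, hN, hlt⟩ := exists_pow_lt_factorial_pow (3 ^ (4 * (K + 3 + 2)))
  let α : Type u := ULift (Fin N)
  have : Nonempty α := ⟨⟨⟨0, hN⟩⟩⟩
  have hchain : ∀ σ : Fin 3 → Fin 3 → Equiv.Perm α, ∃ P, IsSparseChain (lift σ) (K + 3) P := by
    intro σ
    have hw : positiveMergeWidth 1 (lift σ)ᶜ ≤ K := by
      rw [hK]
      exact le_iSup₂_of_le (FinGraph.mk _ (lift σ)ᶜ) ⟨lift σ, isCubic_lift σ, rfl⟩ le_rfl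
    have hw' : positiveMergeWidth 1 (lift σ)ᶜ < ((K + 1 : ℕ) : ℕ∞) :=
      hw.trans_lt (by exact_mod_cast Nat.lt_succ_self K)
    simp only [positiveMergeWidth, iInf_lt_iff] at hw'
    obtain ⟨S, hS, hSw⟩ := hw'
    refine exists_isSparseChain (isCubic_lift σ) S hS (Order.le_of_lt_add_one ?_)
    exact_mod_cast hSw
  have hadj : ∀ (σ : Fin 3 → Fin 3 → Equiv.Perm α) x, ∃ y, (lift σ).Adj x y := by
    intro σ x
    have h3 := (isCubic_lift σ).encard_neighborSet x
    have hne : ((lift σ).neighborSet x).Nonempty := Set.encard_pos.1 (by rw [h3]; norm_num)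
    exact hne
  have hcard := card_le_of_isSparseChain _ (K + 3) _ lift_injective hadj hchain
  have hV : Fintype.card (Fin 3 × α ⊕ Fin 3 × α) = 6 * N := by
    simp [α]; ring
  have hι : Fintype.card (Fin 3 → Fin 3 → Equiv.Perm α) = N.factorial ^ 9 := by
    classical
    simp [Fintype.card_perm, α, ← pow_mul]
  rw [hV, hι] at hcard
  exact absurd hcard (not_le.2 hlt)
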